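/- **Setting.** Let $k$ be a field of characteristic $0$. Rooted trees are finite and taken up to isomorphism; $|t|$ is the number of vertices of $t$, and $\bullet$ is the tree with one vertex. For rooted trees $t,t'$ let $n(t;t')$ be the number of vertices of $t$ to which a new edge (with a new terminal vertex) can be added to obtain $t'$, and let $m(t;t')$ be the number of terminal edges of $t'$ whose removal (together with their terminal vertex) leaves $t$. Kreimer's Hopf algebra $\mathcal H_K$ is, as an algebra, the polynomial algebra over $k$ generated by the rooted trees, graded by giving $t$ degree $|t|$; its monomials are the forests. The counit sends $1$ to $1$ and all elements of positive degree to $0$. The coproduct $\Delta$ is the algebra homomorphism with $$\Delta(t)=t\otimes 1+(\mathrm{id}\otimes B_+)\Delta(t_1\cdots t_n)\qquad\text{for } t=B_+(t_1\cdots t_n),$$ where $B_+$ is the linear map that sends a forest to the tree obtained by joining a new root to the roots of its trees (so $B_+(1)=\bullet$). Let $N$ and $P$ be the derivations of $\mathcal H_K$ with $$N(t)=\sum_{|t'|=|t|+1} n(t;t')\,t',\qquad P(t)=\sum_{|t'|=|t|-1} m(t';t)\,t'\ \ (|t|\ge 2),\qquad P(\bullet)=1 .$$ Let $\mathcal H_K^{gr}=\bigoplus_r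 \big((\mathcal H_K)_r\big)^*$ be the graded dual, with the product $\langle wv,u\rangle=\langle w\otimes v,\Delta(u)\rangle$, with the counit of $\mathcal H_K$ as unit $1$, and with degree-$r$ part $\big((\mathcal H_K)_r\big)^*$. For a rooted tree $t$ let $Z_t\in\mathcal H_K^{gr}$ be given by $\langle Z_t,u\rangle=\delta_{t,u}$ for monomials $u$. Let $N^*,P^*:\mathcal H_K^{gr}\to\mathcal H_K^{gr}$ be the duals of $N$ and $P$, i.e. $\langle N^*(w),u\rangle=\langle w,N(u)\rangle$ and $\langle P^*(w),u\rangle=\langle w,P(u)\rangle$. **Proposition 3.6.** 1. $N^*(Z_\bullet)=0$, and for every rooted tree $t$ with $|t|\ge 2$, $$N^*(Z_t)=\sum_{|t'|=|t|-1} n(t';t)\,Z_{t'} .$$ Moreover, there is a unique linear derivation $\partial/\partial Z_\bullet$ of the algebra $\mathcal H_K^{gr}$ (that is, $\frac{\partial (wv)}{\partial Z_\bullet}=\frac{\partial w}{\partial Z_\bullet}v+w\frac{\partial v}{\partial Z_\bullet}$ for all $w,v$) that sends $Z_\bullet$ to $1$ and $Z_t$ to $0$ for all $t\ne\bullet$,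 and with it $$N^*(wv)=(N^*w)\,v+w\,(N^*v)+\frac{\partial w}{\partial Z_\bullet}\,|v|\,v$$ for all $w\in\mathcal H_K^{gr}$ and all homogeneous $v\in\mathcal H_K^{gr}$, where $|v|$ is the degree of $v$. 2. $P^*(w)=Z_\bullet w$ for all $w\in\mathcal H_K^{gr}$. -/

import Mathlib

open MvPolynomial
open scoped TensorProduct

namespace Kreimer

/-! ### Rooted trees -/

/-- Finite rooted trees with a chosen linear order on the children of every vertex: a root together
with a finite list of branches. -/
inductive PlaneTree : Type
  | node (n : ℕ) (f : Fin n → PlaneTree) : PlaneTree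

namespace PlaneTree

/-- The tree consisting of the root vertex only. -/
def leaf : PlaneTree := node 0 Fin.elim0

/-- The number of vertices. -/
def size : PlaneTree → ℕ
  | node _ f => 1 + ∑ i, (f i).size

/-- Isomorphism of the underlying rooted trees: a bijection of the branches at the root that
matches isomorphic branches. -/
inductive Iso : PlaneTree → PlaneTree → Prop
  | node {n : ℕ} {f g : Fin n → PlaneTree} (σ : Equiv.Perm (Fin n))
      (h : ∀ i, Iso (f i) (g (σ i))) : Iso (node n f) (node n g)

theorem Iso.refl : ∀ t : PlaneTree, Iso t t
  | .node _ f => .node (Equiv.refl _) fun i => Iso.refl (f i)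

theorem Iso.symm {s t : PlaneTree} (h : Iso s t) : Iso t s := by
  induction h with
  | @node n f g σ h ih =>
    refine .node σ.symm fun i => ?_
    have := ih (σ.symm i)
    rwa [Equiv.apply_symm_apply] at this

theorem Iso.trans {s t u : PlaneTree} (h : Iso s t) (h' : Iso t u) : Iso s u := by
  induction h generalizing u with
  | @node n f g σ h ih =>
    cases h' with
    | @node _ _ g' τ h' => exact .node (σ.trans τ) fun i => ih i (h' (σ i))

instance setoid : Setoid PlaneTree := ⟨Iso, Iso.refl, Iso.symm, Iso.trans⟩

/-- The vertices of a tree: the root (`none`), or a vertex of one of the branches at the root. -/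
def Vert : PlaneTree → Type
  | node _ f => Option (Σ i, Vert (f i))

/-- The tree obtained by attaching a new edge with a new terminal vertex to the vertex `v`. -/
def grow : (t : PlaneTree) → Vert t → PlaneTree
  | node n f, none => node (n + 1) (Fin.cons leaf f)
  | node n f, some ⟨i, v⟩ => node n (Function.update f i (grow (f i) v))

/-- The terminal edges of a tree, i.e. the edges that end in a vertex without children: an edge
from the root to a branch that is a single vertex, or a terminal edge of one of the branches. -/
def TermEdge : PlaneTree → Type
  | node _ f => Σ i, PLift (f i = leaf) ⊕ TermEdge (f i)

/-- The tree obtained by removing the terminal edge `e` and the vertex it ends in. -/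
def prune : (t : PlaneTree) → TermEdge t → PlaneTree
  | node 0 _, ⟨i, _⟩ => i.elim0
  | node (n + 1) f, ⟨i, Sum.inl _⟩ => node n fun j => f (i.succAbove j)
  | node (n + 1) f, ⟨i, Sum.inr e⟩ => node (n + 1) (Function.update f i (prune (f i) e))

theorem finite_vert : ∀ t : PlaneTree, Finite (Vert t)
  | node n f => by
    have := fun i => finite_vert (f i)
    exact inferInstanceAs (Finite (Option (Σ i, Vert (f i))))

theorem finite_termEdge : ∀ t : PlaneTree, Finite (TermEdge t)
  | node n f => by
    have := fun i => finite_termEdge (f i)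
    exact inferInstanceAs (Finite (Σ i, PLift (f i = leaf) ⊕ TermEdge (f i)))

theorem Iso.size_eq {s t : PlaneTree} (h : Iso s t) : s.size = t.size := by
  induction h with
  | @node n f g σ h ih =>
    simp only [size]
    rw [Fintype.sum_equiv σ (fun i => (f i).size) (fun i => (g i).size) ih]

theorem size_pos : ∀ t : PlaneTree, 0 < t.size
  | node n f => by simp only [size]; omega

theorem Iso.update {n : ℕ} {f g : Fin n → PlaneTree} (σ : Equiv.Perm (Fin n))
    (h : ∀ i, Iso (f i) (g (σ i))) (i : Fin n) {a b : PlaneTree} (hab : Iso a b) :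
    Iso (PlaneTree.node n (Function.update f i a))
      (PlaneTree.node n (Function.update g (σ i) b)) := by
  refine .node σ fun j => ?_
  by_cases hj : j = i
  · subst hj; simpa using hab
  · rw [Function.update_of_ne hj, Function.update_of_ne (fun e => hj (σ.injective e))]
    exact h j

theorem eq_leaf_of_iso {s t : PlaneTree} (h : Iso s t) (hs : s = leaf) : t = leaf := by
  cases h with
  | @node n f g σ h =>
    unfold leaf at hs
    injection hs with h1 h2
    subst h1
    exact congrArg (PlaneTree.node 0) (Subsingleton.elim _ _)

theorem Iso.vert {s t : PlaneTree} (h : Iso s t) :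
    ∃ e : Vert s ≃ Vert t, ∀ v, Iso (grow s v) (grow t (e v)) := by
  induction h with
  | @node n f g σ h ih =>
    choose e he using ih
    refine ⟨Equiv.optionCongr (Equiv.sigmaCongr σ e), ?_⟩
    rintro (_ | ⟨i, v⟩)
    · change Iso (PlaneTree.node (n + 1) (Fin.cons leaf f))
        (PlaneTree.node (n + 1) (Fin.cons leaf g))
      refine .node (Equiv.Perm.decomposeFin.symm (0, σ)) fun j => ?_
      refine Fin.cases ?_ (fun j => ?_) j
      · simpa using Iso.refl leaf
      · simpa using h j
    · exact Iso.update σ h i (he i v)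

theorem Iso.termEdge {s t : PlaneTree} (h : Iso s t) :
    ∃ e : TermEdge s ≃ TermEdge t, ∀ v, Iso (prune s v) (prune t (e v)) := by
  induction h with
  | @node n f g σ h ih =>
    choose e he using ih
    have hl : ∀ i, f i = leaf ↔ g (σ i) = leaf := fun i =>
      ⟨eq_leaf_of_iso (h i), eq_leaf_of_iso (h i).symm⟩
    refine ⟨Equiv.sigmaCongr σ fun i => Equiv.sumCongr
      (Equiv.plift.trans ((Equiv.ofIff (hl i)).trans Equiv.plift.symm)) (e i), ?_⟩
    cases n with
    | zero => rintro ⟨i, _⟩; exact i.elim0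
    | succ n =>
      rintro ⟨i, _ | v⟩
      · change Iso (PlaneTree.node n fun j => f (i.succAbove j))
          (PlaneTree.node n fun j => g ((σ i).succAbove j))
        let τ : Equiv.Perm (Fin n) := (finSuccAboveEquiv i).trans
          ((σ.subtypeEquiv (p := fun x => x ≠ i) (q := fun x => x ≠ σ i) (fun a => by simp)).trans
            (finSuccAboveEquiv (σ i)).symm)
        refine .node τ fun j => ?_
        have : (σ i).succAbove (τ j) = σ (i.succAbove j) := by
          have h1 : finSuccAboveEquiv (σ i) (τ j) =
              ⟨σ (i.succAbove j), fun e => Fin.succAbove_ne i j (σ.injective e)⟩ := by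
            simp only [τ, Equiv.trans_apply, Equiv.apply_symm_apply]
            rfl
          exact congrArg Subtype.val h1
        rw [this]
        exact h _
      · exact Iso.update σ h i (he i v)

theorem finite_size_le (m : ℕ) : {t : PlaneTree | t.size ≤ m}.Finite := by
  induction m with
  | zero =>
    refine Set.Finite.subset Set.finite_empty fun t ht => ?_
    have := size_pos t
    simp only [Set.mem_ofPred_eq] at ht
    omega
  | succ m ih =>
    refine Set.Finite.subset (Set.Finite.biUnion (Set.finite_Iic m) fun n _ =>
      (Set.Finite.pi (ι := Fin n) (t := fun _ => {t : PlaneTree | t.size ≤ m})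
        fun _ => ih).image (PlaneTree.node n)) ?_
    rintro ⟨n, f⟩ ht
    simp only [Set.mem_ofPred_eq, size] at ht
    have h1 : (n : ℕ) ≤ ∑ i, (f i).size := by
      calc n = ∑ _i : Fin n, 1 := by simp
        _ ≤ _ := Finset.sum_le_sum fun i _ => size_pos (f i)
    refine Set.mem_biUnion (x := n) (by simp only [Set.mem_Iic]; omega) ⟨f, ?_, rfl⟩
    intro i _
    have h2 : (f i).size ≤ ∑ i, (f i).size :=
      Finset.single_le_sum (f := fun i => (f i).size) (fun _ _ => Nat.zero_le _) (Finset.mem_univ i)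
    simp only [Set.mem_ofPred_eq]
    omega

end PlaneTree

/-- (Isomorphism classes of) finite rooted trees. -/
def RTree : Type := Quotient PlaneTree.setoid

namespace RTree

/-- The isomorphism class of a plane tree. -/
def mk (t : PlaneTree) : RTree := Quotient.mk PlaneTree.setoid t

/-- The tree `•` with a single vertex. -/
def bullet : RTree := mk PlaneTree.leaf

/-- The number `|t|` of vertices of `t`. -/
def size : RTree → ℕ := Quotient.lift PlaneTree.size fun _ _ h => PlaneTree.Iso.size_eq h

/-- `n(t;t')`: the number of vertices of `t` to which a new edge can be added to obtain `t'`. -/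
noncomputable def n (t t' : RTree) : ℕ :=
  Quotient.lift (fun s : PlaneTree => Nat.card {v : s.Vert // mk (s.grow v) = t'})
    (fun s₁ s₂ h => by
      obtain ⟨e, he⟩ := PlaneTree.Iso.vert h
      refine Nat.card_congr (e.subtypeEquiv fun v => ?_)
      rw [show mk (s₁.grow v) = mk (s₂.grow (e v)) from Quotient.sound (he v)]) t

/-- `m(t;t')`: the number of (terminal) edges of `t'` which when removed leave `t`. -/
noncomputable def m (t t' : RTree) : ℕ :=
  Quotient.lift (fun s : PlaneTree => Nat.card {e : s.TermEdge // mk (s.prune e) = t})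
    (fun s₁ s₂ h => by
      obtain ⟨e, he⟩ := PlaneTree.Iso.termEdge h
      refine Nat.card_congr (e.subtypeEquiv fun v => ?_)
      rw [show mk (s₁.prune v) = mk (s₂.prune (e v)) from Quotient.sound (he v)]) t'

theorem finite_size_eq (r : ℕ) : {t : RTree | t.size = r}.Finite := by
  refine Set.Finite.subset ((PlaneTree.finite_size_le r).image mk) ?_
  rintro ⟨s⟩ hs
  exact ⟨s, le_of_eq hs, rfl⟩

/-- The finite set of all rooted trees with `r` vertices. -/
noncomputable def ofSize (r : ℕ) : Finset RTree := (finite_size_eq r).toFinset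

/-- The tree `B₊(t₁ ⋯ tₙ)`: a new root connected to the roots of all the trees of a forest. -/
noncomputable def bPlus (s : Multiset RTree) : RTree :=
  mk (PlaneTree.node s.toList.length fun i => (s.toList.get i).out)

theorem size_pos (t : RTree) : 0 < t.size := by
  induction t using Quotient.inductionOn with
  | _ s => exact s.size_pos

theorem mem_ofSize {r : ℕ} {t : RTree} : t ∈ ofSize r ↔ t.size = r := by
  simp [ofSize]

theorem mk_out (t : RTree) : mk t.out = t := Quotient.out_eq t

theorem size_out (t : RTree) : t.out.size = t.size := by
  conv_rhs => rw [← mk_out t]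
  rfl

theorem size_bPlus (s : Multiset RTree) : (bPlus s).size = 1 + (s.map size).sum := by
  change 1 + ∑ i : Fin s.toList.length, ((s.toList.get i).out).size = _
  simp only [size_out]
  rw [← List.sum_ofFn]
  congr 1
  conv_rhs => rw [← Multiset.coe_toList s, Multiset.map_coe, Multiset.sum_coe]
  congr 1
  apply List.ext_get <;> simp

/-- The branches at the root of `B₊` of a forest are the trees of the forest. -/
theorem bPlus_map_mk {r : ℕ} (f : Fin r → PlaneTree) :
    bPlus (Finset.univ.val.map fun i => mk (f i)) = mk (PlaneTree.node r f) := by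
  set s : Multiset RTree := Finset.univ.val.map fun i => mk (f i) with hs
  have h1 : s = ((List.ofFn fun i => mk (f i) : List RTree) : Multiset RTree) := by
    rw [hs, Fin.univ_val_map]
  have hp : (s.toList : Multiset RTree) = s := Multiset.coe_toList s
  have hlen : s.toList.length = r := by rw [Multiset.length_toList, hs]; simp
  unfold bPlus
  generalize s.toList = l at hp hlen
  subst hlen
  have h2 : (Finset.univ.val.map l.get : Multiset RTree) = Finset.univ.val.map fun i => mk (f i) := by
    rw [Fin.univ_val_map, List.ofFn_get, hp]
  have h3 : ∀ c : RTree, Nonempty ({i // l.get i = c} ≃ {i // mk (f i) = c}) := fun c => by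
    classical
    refine ⟨Fintype.equivOfCardEq ?_⟩
    have := congrArg (Multiset.count c) h2
    rw [Multiset.count_map, Multiset.count_map] at this
    simp only [eq_comm (a := c)] at this
    rw [Fintype.card_subtype, Fintype.card_subtype]
    exact this
  let e := fun c => (h3 c).some
  refine Quotient.sound (s := PlaneTree.setoid)
    (PlaneTree.Iso.node (Equiv.ofFiberEquiv e) fun i => ?_)
  have h4 := Equiv.ofFiberEquiv_map e i
  exact Quotient.exact ((mk_out _).trans h4.symm)

end RTree

/-! ### The Hopf algebra of rooted trees -/

section Algebra

variable (k : Type*) [Field k]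

/-- As an algebra, `H_K` is the polynomial algebra generated by the rooted trees; its monomials are
the forests. -/
abbrev HK : Type _ := MvPolynomial RTree k

/-- The degree-`r` part of `H_K`, where a tree `t` has degree `|t|`. -/
noncomputable abbrev HKdeg (r : ℕ) : Submodule k (HK k) :=
  weightedHomogeneousSubmodule k RTree.size r

/-- The linear map `B₊` sending a forest `t₁ ⋯ tₙ` to the tree `B₊(t₁ ⋯ tₙ)`. -/
noncomputable def BPlus : HK k →ₗ[k] HK k :=
  (basisMonomials RTree k).constr k fun u => X (RTree.bPlus (Finsupp.toMultiset u))

/-- The recursion `Δ(t) = t ⊗ 1 + (id ⊗ B₊) (Δ(t₁) ⋯ Δ(tₙ))` for `t = B₊(t₁ ⋯ tₙ)`. -/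
noncomputable def comulTree : PlaneTree → HK k ⊗[k] HK k
  | .node r f => X (RTree.mk (.node r f)) ⊗ₜ[k] 1 +
      TensorProduct.map LinearMap.id (BPlus k) (∏ i, comulTree (f i))

theorem comulTree_eq {s t : PlaneTree} (h : PlaneTree.Iso s t) :
    comulTree k s = comulTree k t := by
  induction h with
  | @node r f g σ h ih =>
    have h1 : RTree.mk (.node r f) = RTree.mk (.node r g) := Quotient.sound (.node σ h)
    simp only [comulTree, h1]
    rw [Fintype.prod_equiv σ (fun i => comulTree k (f i)) (fun i => comulTree k (g i)) ih]

/-- The comultiplication `Δ` of `H_K`. -/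
noncomputable def comul : HK k →ₐ[k] HK k ⊗[k] HK k :=
  aeval (Quotient.lift (comulTree k) fun _ _ h => comulTree_eq k h)

/-- The counit of `H_K`: it sends `1` to `1` and all elements of positive degree to `0`. -/
noncomputable def counit : HK k →ₗ[k] k := (aeval fun _ : RTree => (0 : k)).toLinearMap

/-- The growth operator `𝔑(t) = ∑ n(t;t') t'` on trees. -/
noncomputable def growTree (t : RTree) : HK k :=
  ∑ t' ∈ RTree.ofSize (t.size + 1), (RTree.n t t' : k) • X t'

/-- The pruning operator `𝔓(t) = ∑ m(t';t) t'` on trees. -/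
noncomputable def pruneTree (t : RTree) : HK k :=
  ∑ t' ∈ RTree.ofSize (t.size - 1), (RTree.m t' t : k) • X t'

/-- The growth operator `N` on `H_K`: the derivation with `N(t) = 𝔑(t)` for every tree `t`. -/
noncomputable def N : Derivation k (HK k) (HK k) := mkDerivation k (growTree k)

open Classical in
/-- The pruning operator `P` on `H_K`: the derivation with `P(t) = 𝔓(t)` for every tree `t` with
`|t| ≥ 2`, and `P(•) = 1`. -/
noncomputable def P : Derivation k (HK k) (HK k) :=
  mkDerivation k fun t => if t = RTree.bullet then 1 else pruneTree k t

/-- Induction on forests, adding one tree at a time. -/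
theorem forest_induction {p : (RTree →₀ ℕ) → Prop} (h0 : p 0)
    (h1 : ∀ t u, p u → p (Finsupp.single t 1 + u)) (u : RTree →₀ ℕ) : p u := by
  classical
  rw [← Finsupp.toMultiset_toFinsupp u]
  induction Finsupp.toMultiset u using Multiset.induction_on with
  | empty => simpa using h0
  | cons t s ih =>
    rw [← Multiset.singleton_add, Multiset.toFinsupp_add, Multiset.toFinsupp_singleton]
    exact h1 t _ ih

theorem monomial_single_add (t : RTree) (u : RTree →₀ ℕ) :
    (monomial (Finsupp.single t 1 + u) 1 : HK k) = X t * monomial u 1 := by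
  rw [X, monomial_mul, one_mul]

theorem BPlus_monomial (u : RTree →₀ ℕ) :
    BPlus k (monomial u 1) = X (RTree.bPlus (Finsupp.toMultiset u)) := by
  have := (basisMonomials RTree k).constr_basis k
    (fun u => (X (RTree.bPlus (Finsupp.toMultiset u)) : HK k)) u
  rwa [coe_basisMonomials] at this

theorem monomial_eq_prod (u : RTree →₀ ℕ) :
    (monomial u 1 : HK k) = ((Finsupp.toMultiset u).map X).prod := by
  induction u using forest_induction with
  | h0 => simp
  | h1 t u ih => rw [monomial_single_add, ih, map_add, Finsupp.toMultiset_single]; simp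

theorem comul_X (t : PlaneTree) : comul k (X (RTree.mk t)) = comulTree k t :=
  aeval_X _ _

/-- The recursive formula `Δ(t) = t ⊗ 1 + (id ⊗ B₊)Δ(B₋(t))`, where `t = B₊(u)`. -/
theorem comul_BPlus (u : RTree →₀ ℕ) : comul k (BPlus k (monomial u 1)) =
    BPlus k (monomial u 1) ⊗ₜ[k] 1 +
      TensorProduct.map LinearMap.id (BPlus k) (comul k (monomial u 1)) := by
  have hX : ∀ t : PlaneTree, comul k (X (RTree.mk t)) = comulTree k t :=
    comul_X k
  rw [BPlus_monomial, monomial_eq_prod]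
  generalize Finsupp.toMultiset u = s
  have hs : s = Finset.univ.val.map fun i : Fin s.toList.length =>
      RTree.mk (s.toList.get i).out := by
    simp only [RTree.mk_out]
    rw [Fin.univ_val_map]
    exact (Multiset.coe_toList s).symm.trans (congrArg _ (List.ofFn_get s.toList).symm)
  rw [RTree.bPlus, hX, comulTree]
  congr 2
  conv_rhs => rw [hs, Multiset.map_map, map_multiset_prod, Multiset.map_map]
  simp only [Finset.prod, Function.comp_def, hX]

/-! ### The grading -/

/-- The degree-`r` part of `H_K ⊗ H_K`. -/
noncomputable def tensorDeg (r : ℕ) : Submodule k (HK k ⊗[k] HK k) :=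
  Submodule.span k {x | ∃ i j, i + j = r ∧ ∃ a ∈ HKdeg k i, ∃ b ∈ HKdeg k j, x = a ⊗ₜ[k] b}

variable {k}

theorem mul_mem_tensorDeg {r s : ℕ} {x y : HK k ⊗[k] HK k} (hx : x ∈ tensorDeg k r)
    (hy : y ∈ tensorDeg k s) : x * y ∈ tensorDeg k (r + s) := by
  have h := Submodule.mul_mem_mul hx hy
  unfold tensorDeg at h
  rw [Submodule.span_mul_span] at h
  refine Submodule.span_mono ?_ h
  rintro _ ⟨_, ⟨i, j, rfl, a, ha, b, hb, rfl⟩, _, ⟨i', j', rfl, a', ha', b', hb', rfl⟩, rfl⟩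
  refine ⟨i + i', j + j', by ring, a * a', ?_, b * b', ?_, by simp⟩
  · exact IsWeightedHomogeneous.mul ha ha'
  · exact IsWeightedHomogeneous.mul hb hb'

theorem one_mem_tensorDeg : (1 : HK k ⊗[k] HK k) ∈ tensorDeg k 0 :=
  Submodule.subset_span ⟨0, 0, rfl, 1, isWeightedHomogeneous_one _ _, 1,
    isWeightedHomogeneous_one _ _, rfl⟩

theorem prod_mem_tensorDeg {ι : Type*} (s : Finset ι) (d : ι → ℕ) (x : ι → HK k ⊗[k] HK k)
    (hx : ∀ i ∈ s, x i ∈ tensorDeg k (d i)) : ∏ i ∈ s, x i ∈ tensorDeg k (∑ i ∈ s, d i) := by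
  classical
  induction s using Finset.induction_on with
  | empty => exact one_mem_tensorDeg
  | insert i s hi ih =>
    rw [Finset.prod_insert hi, Finset.sum_insert hi]
    exact mul_mem_tensorDeg (hx i (Finset.mem_insert_self i s))
      (ih fun j hj => hx j (Finset.mem_insert_of_mem hj))

/-- A linear map is determined on the degree-`r` part by its values on forests of degree `r`. -/
theorem map_mem_of_monomial {M : Type*} [AddCommGroup M] [Module k M] (L : HK k →ₗ[k] M)
    (S : Submodule k M) {r : ℕ}
    (h : ∀ u : RTree →₀ ℕ, Finsupp.weight RTree.size u = r → L (monomial u 1) ∈ S)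
    {x : HK k} (hx : x ∈ HKdeg k r) : L x ∈ S := by
  rw [x.as_sum, map_sum]
  refine Submodule.sum_mem _ fun u hu => ?_
  rw [← mul_one (coeff u x), ← smul_eq_mul, ← smul_monomial, map_smul]
  exact S.smul_mem _ (h u (hx (mem_support_iff.1 hu)))

theorem BPlus_mem {r : ℕ} {x : HK k} (hx : x ∈ HKdeg k r) : BPlus k x ∈ HKdeg k (1 + r) := by
  refine map_mem_of_monomial _ _ (fun u hu => ?_) hx
  rw [BPlus_monomial]
  have h : (RTree.bPlus (Finsupp.toMultiset u)).size = 1 + r := by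
    rw [RTree.size_bPlus, ← hu]
    congr 1
    clear hu
    induction u using forest_induction with
    | h0 => simp
    | h1 t u ih =>
      rw [map_add, map_add, Finsupp.toMultiset_single, Finsupp.weight_single]
      simp [ih]
  rw [← h]
  exact isWeightedHomogeneous_X _ _ _

theorem comulTree_mem : ∀ t : PlaneTree, comulTree k t ∈ tensorDeg k t.size
  | .node r f => by
    have ih := prod_mem_tensorDeg Finset.univ (fun i => (f i).size) (fun i => comulTree k (f i))
      fun i _ => comulTree_mem (f i)
    simp only [comulTree, PlaneTree.size]
    refine Submodule.add_mem _ (Submodule.subset_span ⟨_, 0, add_zero _, _,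
      isWeightedHomogeneous_X _ _ (RTree.mk (.node r f)), 1, isWeightedHomogeneous_one _ _, rfl⟩) ?_
    generalize ∏ i, comulTree k (f i) = x at ih
    generalize ∑ i, (f i).size = d at ih
    refine Submodule.span_induction (p := fun x _ => TensorProduct.map LinearMap.id (BPlus k) x ∈
      tensorDeg k (1 + d)) ?_ ?_ ?_ ?_ ih
    · rintro _ ⟨i, j, rfl, a, ha, b, hb, rfl⟩
      exact Submodule.subset_span ⟨i, 1 + j, by ring, a, ha, _, BPlus_mem hb, by simp⟩
    · simp
    · intro x y _ _ hx hy
      rw [map_add]; exact Submodule.add_mem _ hx hy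
    · intro c x _ hx
      rw [map_smul]; exact Submodule.smul_mem _ c hx

theorem comul_mem {r : ℕ} {x : HK k} (hx : x ∈ HKdeg k r) : comul k x ∈ tensorDeg k r := by
  refine map_mem_of_monomial (comul k).toLinearMap _ (fun u hu => ?_) hx
  subst hu
  clear hx
  induction u using forest_induction with
  | h0 => simpa using one_mem_tensorDeg
  | h1 t u ih =>
    rw [monomial_single_add, AlgHom.toLinearMap_apply, map_mul, map_add, Finsupp.weight_single,
      one_smul]
    refine mul_mem_tensorDeg ?_ ih
    induction t using Quotient.inductionOn with
    | _ t =>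
      exact (comul_X k t).symm ▸ comulTree_mem (k := k) t

theorem N_mem {r : ℕ} {x : HK k} (hx : x ∈ HKdeg k r) : N k x ∈ HKdeg k (r + 1) := by
  refine map_mem_of_monomial (N k).toLinearMap _ (fun u hu => ?_) hx
  subst hu
  clear hx
  induction u using forest_induction with
  | h0 =>
    rw [show (monomial 0 1 : HK k) = 1 from rfl, Derivation.coeFn_coe,
      Derivation.map_one_eq_zero]
    exact zero_mem _
  | h1 t u ih =>
    rw [monomial_single_add, Derivation.coeFn_coe,
      Derivation.leibniz, map_add, Finsupp.weight_single, one_smul]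
    refine Submodule.add_mem _ ?_ ?_
    · rw [smul_eq_mul, add_assoc]
      exact IsWeightedHomogeneous.mul (isWeightedHomogeneous_X _ _ _) ih
    · rw [smul_eq_mul, add_comm, ← add_assoc, mul_comm, add_comm 1]
      refine IsWeightedHomogeneous.mul ?_ (isWeightedHomogeneous_monomial _ _ _ rfl)
      rw [N, mkDerivation_X, growTree]
      refine Submodule.sum_mem (HKdeg k _) fun t' ht' => Submodule.smul_mem _ _ ?_
      rw [← RTree.mem_ofSize.1 ht']
      exact isWeightedHomogeneous_X _ _ _

theorem P_X_mem (t : RTree) : P k (X t) ∈ HKdeg k (t.size - 1) := by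
  rw [P, mkDerivation_X]
  split_ifs with h
  · subst h
    exact isWeightedHomogeneous_one _ _
  · refine Submodule.sum_mem _ fun t' ht' => Submodule.smul_mem _ _ ?_
    rw [← RTree.mem_ofSize.1 ht']
    exact isWeightedHomogeneous_X _ _ _

theorem P_mem {r : ℕ} {x : HK k} (hx : x ∈ HKdeg k (r + 1)) : P k x ∈ HKdeg k r := by
  refine map_mem_of_monomial (P k).toLinearMap _ (fun u hu => ?_) hx
  clear hx
  rw [Derivation.coeFn_coe]
  induction u using forest_induction generalizing r with
  | h0 => simp at hu
  | h1 t u ih =>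
    rw [map_add, Finsupp.weight_single, one_smul] at hu
    have ht := t.size_pos
    rw [monomial_single_add, Derivation.leibniz, smul_eq_mul, smul_eq_mul]
    refine Submodule.add_mem _ ?_ ?_
    · rcases Nat.eq_zero_or_pos (Finsupp.weight RTree.size u) with h0 | h0
      · have : u = 0 := by
          ext s
          by_contra hs
          have := Finsupp.le_weight_of_ne_zero' RTree.size hs
          have := s.size_pos
          omega
        subst this
        rw [show (monomial 0 1 : HK k) = 1 from rfl, Derivation.map_one_eq_zero, mul_zero]
        exact zero_mem _
      · have h := IsWeightedHomogeneous.mul (isWeightedHomogeneous_X k RTree.size t)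
          (ih (r := Finsupp.weight RTree.size u - 1) (by omega))
        rwa [show t.size + (Finsupp.weight RTree.size u - 1) = r by omega] at h
    · have h := IsWeightedHomogeneous.mul
        (isWeightedHomogeneous_monomial RTree.size u (1 : k) rfl) (P_X_mem (k := k) t)
      rwa [show Finsupp.weight RTree.size u + (t.size - 1) = r by omega] at h

/-! ### The graded dual -/

variable (k)

/-- The graded dual of `H_K`, i.e. the direct sum of the duals of the homogeneous parts: the linear
functionals that vanish on all homogeneous parts of sufficiently large degree. -/
noncomputable def gradedDual : Submodule k (Module.Dual k (HK k)) where
  carrier := {w | ∃ a, ∀ r, a ≤ r → ∀ x ∈ HKdeg k r, w x = 0}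
  add_mem' := by
    rintro w v ⟨a, ha⟩ ⟨b, hb⟩
    exact ⟨max a b, fun r hr x hx => by
      simp [ha r (le_trans (le_max_left _ _) hr) x hx, hb r (le_trans (le_max_right _ _) hr) x hx]⟩
  zero_mem' := ⟨0, by simp⟩
  smul_mem' := by
    rintro c w ⟨a, ha⟩
    exact ⟨a, fun r hr x hx => by simp [ha r hr x hx]⟩

/-- The graded dual `H_K^gr`. -/
abbrev HKgr : Type _ := ↥(gradedDual k)

/-- The degree-`r` part of `H_K^gr`: the functionals vanishing on all other homogeneous parts. -/
noncomputable def HKgrDeg (r : ℕ) : Submodule k (HKgr k) where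
  carrier := {w | ∀ s, s ≠ r → ∀ x ∈ HKdeg k s, w.1 x = 0}
  add_mem' := by
    intro w v hw hv s hs x hx
    simp [hw s hs x hx, hv s hs x hx]
  zero_mem' := by intro s _ x _; simp
  smul_mem' := by
    intro c w hw s hs x hx
    simp [hw s hs x hx]

variable {k}

/-- The product of `H_K^gr`, dual to the coproduct: `⟨w v, x⟩ = ⟨w ⊗ v, Δ(x)⟩`. -/
noncomputable instance : Mul (HKgr k) where
  mul w v := ⟨LinearMap.mul' k k ∘ₗ TensorProduct.map w.1 v.1 ∘ₗ (comul k).toLinearMap, by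
    obtain ⟨w, a, ha⟩ := w
    obtain ⟨v, b, hb⟩ := v
    refine ⟨a + b, fun r hr x hx => ?_⟩
    have h := comul_mem hx
    simp only [LinearMap.comp_apply, AlgHom.toLinearMap_apply]
    refine Submodule.span_induction (p := fun y _ =>
      LinearMap.mul' k k (TensorProduct.map w v y) = 0) ?_ ?_ ?_ ?_ h
    · rintro _ ⟨i, j, rfl, y, hy, z, hz, rfl⟩
      rcases le_or_gt a i with hi | hi
      · simp [ha i hi y hy]
      · simp [hb j (by omega) z hz]
    · simp
    · intro y z _ _ hy hz
      simp [hy, hz]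
    · intro c y _ hy
      simp [hy]⟩

/-- The unit of `H_K^gr`, which is the counit of `H_K`. -/
noncomputable instance : One (HKgr k) where
  one := ⟨counit k, 1, fun r hr x hx => by
    have h : coeff 0 x = 0 := hx.coeff_eq_zero 0 (by rw [map_zero]; omega)
    simpa [counit, aeval_zero', constantCoeff_eq] using h⟩

variable (k)

/-- `Z_t`, with `⟨Z_t, u⟩ = δ_{t,u}` for monomials `u`. -/
noncomputable def Z (t : RTree) : HKgr k :=
  ⟨lcoeff k (Finsupp.single t 1), t.size + 1, fun r hr x hx => by
    by_contra h
    have h1 := hx h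
    rw [Finsupp.weight_single] at h1
    simp at h1
    omega⟩

/-- The dual `N*` of the growth operator: `⟨N*(w), u⟩ = ⟨w, N(u)⟩`. -/
noncomputable def Nstar : HKgr k →ₗ[k] HKgr k :=
  ((N k).toLinearMap.dualMap.domRestrict (gradedDual k)).codRestrict (gradedDual k) fun w => by
    obtain ⟨w, a, ha⟩ := w
    exact ⟨a, fun r hr x hx => ha (r + 1) (by omega) _ (N_mem hx)⟩

/-- The dual `P*` of the pruning operator: `⟨P*(w), u⟩ = ⟨w, P(u)⟩`. -/
noncomputable def Pstar : HKgr k →ₗ[k] HKgr k :=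
  ((P k).toLinearMap.dualMap.domRestrict (gradedDual k)).codRestrict (gradedDual k) fun w => by
    obtain ⟨w, a, ha⟩ := w
    refine ⟨a + 1, fun r hr x hx => ?_⟩
    obtain ⟨r, rfl⟩ : ∃ r', r = r' + 1 := ⟨r - 1, by omega⟩
    exact ha r (by omega) _ (P_mem hx)

variable {k}

open Classical in
/-- `d` is the partial derivative `∂/∂Z_•` of the (noncommutative) algebra `H_K^gr`: the linear
derivation sending `Z_•` to `1` and every other generator `Z_t` to `0`. -/
structure IsPartialZBullet (d : HKgr k →ₗ[k] HKgr k) : Prop where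
  leibniz : ∀ w v : HKgr k, d (w * v) = d w * v + w * d v
  apply_Z : ∀ t : RTree, d (Z k t) = if t = RTree.bullet then 1 else 0

end Algebra

end Kreimer

namespace Kreimer

/-! ### Sums over vertices and terminal edges, and sizes after growing and pruning. -/

namespace PlaneTree

/-! Both parts are dual to identities about `Δ` on `H_K`, and these are proved by one induction: the
trees are built from `1` by products and `B₊`, so it suffices to know how each operator behaves on
products and on `B₊(x)`. No coassociativity is needed.

For `P*`: since `Z_•` is a derivation over the counit, `(Z_• ⊗ id)Δ` is a derivation of `H_K`. The
recursion for `Δ` shows that it satisfies the same recursion along `B₊` as `P`, hence equals `P`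
(`sliceDerivation_Z_bullet`), and dualizing gives `P*(w) = Z_• w`.

For `N*`: growing a tree either grows a branch or attaches a vertex to the root, so `N B₊(x) = B₊(N
x) + B₊(• x)` (`N_BPlus`). With `Y` the degree derivation, this leads to `Δ N = (N ⊗ id + id ⊗ N + •
⊗ Y) Δ` (`comul_N`), whose dual is the twisted Leibniz rule, `∂/∂Z_•` being the dual of
multiplication by `•`. The latter is a derivation because `•` is primitive. The values `N*(Z_t)` are
found by comparing infinitesimal characters on trees (`Nstar_Z`).

Uniqueness of `∂/∂Z_•` holds because in characteristic `0` the `Z_t` generate the graded dual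
(`eq_top_of_Z_mul_mem`): to leading order in the number of trees, left multiplication by `Z_t` is
dual to the partial derivative in the variable `t`. -/

noncomputable instance fintypeVert (t : PlaneTree) : Fintype (Vert t) :=
  have := finite_vert t
  Fintype.ofFinite _

noncomputable instance fintypeTermEdge (t : PlaneTree) : Fintype (TermEdge t) :=
  have := finite_termEdge t
  Fintype.ofFinite _

/-- The description of the vertices of a tree through those of its branches. -/
def vertNodeEquiv {n : ℕ} (f : Fin n → PlaneTree) :
    Vert (node n f) ≃ Option (Σ i, Vert (f i)) := Equiv.refl _

/-- The description of the terminal edges of a tree through those of its branches. -/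
def termEdgeNodeEquiv {n : ℕ} (f : Fin n → PlaneTree) :
    TermEdge (node n f) ≃ Σ i, PLift (f i = leaf) ⊕ TermEdge (f i) := Equiv.refl _

/-- The `Fintype` instance on `Vert (node n f)` comes from mere finiteness and differs from the one
on `Option`; summing along the identity equivalence passes from one to the other. -/
theorem sum_vert_node {M : Type*} [AddCommMonoid M] {n : ℕ} (f : Fin n → PlaneTree)
    (F : Vert (node n f) → M) :
    ∑ v, F v = F (none : Option (Σ i, Vert (f i))) +
      ∑ i, ∑ v : Vert (f i), F (some ⟨i, v⟩ : Option (Σ i, Vert (f i))) := by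
  rw [← Fintype.sum_sigma' (fun i v => F (some ⟨i, v⟩ : Option (Σ i, Vert (f i))))]
  let G : Option (Σ i, Vert (f i)) → M := F
  exact (Fintype.sum_equiv (vertNodeEquiv f) F G fun _ => rfl).trans
    (Fintype.sum_option G)

open Classical in
theorem sum_termEdge_node {M : Type*} [AddCommMonoid M] {n : ℕ} (f : Fin n → PlaneTree)
    (F : (Σ i, PLift (f i = leaf) ⊕ TermEdge (f i)) → M) :
    ∑ e : TermEdge (node n f), F e = ∑ i, ((if h : f i = leaf then F ⟨i, Sum.inl ⟨h⟩⟩ else 0) +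
      ∑ e : TermEdge (f i), F ⟨i, Sum.inr e⟩) := by
  trans ∑ e : (Σ i, PLift (f i = leaf) ⊕ TermEdge (f i)), F e
  · exact Fintype.sum_equiv (termEdgeNodeEquiv f) (fun e => F e) F fun _ => rfl
  · rw [Fintype.sum_sigma]
    refine Finset.sum_congr rfl fun i _ => ?_
    rw [Fintype.sum_sum_type]
    congr 1
    split_ifs with h
    · have : Unique (PLift (f i = leaf)) := ⟨⟨⟨h⟩⟩, fun _ => rfl⟩
      rw [Fintype.sum_unique]
    · have : IsEmpty (PLift (f i = leaf)) := ⟨fun a => h a.down⟩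
      simp

/-- The additive form avoids truncated subtraction and serves growing and pruning alike. -/
theorem size_update_add {n : ℕ} (f : Fin n → PlaneTree) (i : Fin n) (s : PlaneTree) :
    ∑ j, (Function.update f i s j).size + (f i).size = ∑ j, (f j).size + s.size := by
  classical
  simp only [Function.apply_update (fun _ => size) f i s]
  rw [Finset.sum_update_of_mem (Finset.mem_univ i),
    ← Finset.add_sum_erase _ (fun j => (f j).size) (Finset.mem_univ i),
    Finset.sdiff_singleton_eq_erase]
  omega

theorem size_grow : ∀ (t : PlaneTree) (v : Vert t), (grow t v).size = t.size + 1
  | node n f, none => by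
    change size (node (n + 1) (Fin.cons leaf f)) = _
    simp only [size, Fin.sum_univ_succ, Fin.cons_zero, Fin.cons_succ, leaf, Finset.univ_eq_empty,
      Finset.sum_empty]
    omega
  | node n f, some ⟨i, v⟩ => by
    change size (node n (Function.update f i (grow (f i) v))) = _
    have h := size_update_add f i (grow (f i) v)
    rw [size_grow (f i) v] at h
    simp only [size]
    omega

theorem size_prune : ∀ (t : PlaneTree) (e : TermEdge t), (prune t e).size + 1 = t.size
  | node 0 _, e => (e : Σ i : Fin 0, PLift (_ = leaf) ⊕ TermEdge _).1.elim0
  | node (n + 1) f, ⟨i, Sum.inl h⟩ => by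
    change size (node n fun j => f (i.succAbove j)) + 1 = _
    simp only [size]
    rw [Fin.sum_univ_succAbove _ i, h.down]
    simp only [size, leaf, Finset.univ_eq_empty, Finset.sum_empty]
    omega
  | node (n + 1) f, ⟨i, Sum.inr e⟩ => by
    change size (node (n + 1) (Function.update f i (prune (f i) e))) + 1 = _
    have h := size_update_add f i (prune (f i) e)
    have h' := size_prune (f i) e
    simp only [size]
    omega

instance isEmpty_termEdge_leaf : IsEmpty (TermEdge leaf) :=
  ⟨fun e => (e : Σ _ : Fin 0, PLift (_ = leaf) ⊕ TermEdge _).1.elim0⟩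

theorem mk_eq_bullet_iff {s : PlaneTree} : RTree.mk s = RTree.bullet ↔ s = leaf :=
  ⟨fun h => eq_leaf_of_iso (Iso.symm (Quotient.exact h)) rfl, fun h => by rw [h]; rfl⟩

end PlaneTree

/-! ### The operators `N` and `P` on trees and their behaviour along `B₊`. -/

section Algebra

variable (k : Type*) [Field k]

/-- Grouping vertices or edges by the resulting tree removes the multiplicities `n` and `m`: from
here on `N` and `P` are plain sums over vertices and terminal edges of a representative. -/
theorem sum_card_fiber_smul {ι : Type*} [Fintype ι] (F : ι → RTree) (S : Finset RTree)
    (hF : ∀ i, F i ∈ S) :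
    ∑ t ∈ S, (Nat.card {i // F i = t} : k) • (X t : HK k) = ∑ i, X (F i) := by
  classical
  rw [← Finset.sum_fiberwise_of_maps_to (s := Finset.univ) (t := S) (g := F) fun i _ => hF i]
  refine Finset.sum_congr rfl fun t _ => ?_
  rw [Finset.sum_congr rfl (g := fun _ => (X t : HK k)) fun i hi => by
    rw [(Finset.mem_filter.1 hi).2]]
  rw [Finset.sum_const, Nat.card_eq_fintype_card, Fintype.card_subtype, Nat.cast_smul_eq_nsmul]

theorem N_X_mk (s : PlaneTree) : N k (X (RTree.mk s)) = ∑ v, X (RTree.mk (s.grow v)) := by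
  rw [N, mkDerivation_X]
  exact sum_card_fiber_smul k (fun v => RTree.mk (s.grow v)) _
    fun v => RTree.mem_ofSize.2 (s.size_grow v)

open Classical in
theorem P_X_mk (s : PlaneTree) : P k (X (RTree.mk s)) =
    (if s = PlaneTree.leaf then 1 else 0) + ∑ e, X (RTree.mk (s.prune e)) := by
  rw [P, mkDerivation_X]
  simp only [PlaneTree.mk_eq_bullet_iff]
  split_ifs with h
  · subst h
    simp
  · rw [zero_add]
    exact sum_card_fiber_smul k (fun v => RTree.mk (s.prune v)) _
      fun v => RTree.mem_ofSize.2 (Nat.eq_sub_of_add_eq (s.size_prune v))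

variable {k}

/-- The Leibniz rule is phrased with `Function.update` to match `grow` and `prune`, which replace a
single branch. -/
theorem derivation_prod {ι : Type*} [Fintype ι] [DecidableEq ι]
    (D : Derivation k (HK k) (HK k)) (f : ι → HK k) :
    D (∏ i, f i) = ∑ i, ∏ j, Function.update f i (D (f i)) j := by
  have key : ∀ s : Finset ι, D (∏ i ∈ s, f i) = ∑ i ∈ s, D (f i) * ∏ j ∈ s.erase i, f j := by
    intro s
    induction s using Finset.induction_on with
    | empty => simp
    | insert a s ha ih =>
      rw [Finset.prod_insert ha, Derivation.leibniz, ih, Finset.sum_insert ha,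
        Finset.erase_insert ha, smul_eq_mul, smul_eq_mul, add_comm, Finset.mul_sum, mul_comm]
      congr 1
      refine Finset.sum_congr rfl fun i hi => ?_
      have hai : a ≠ i := fun h => ha (h ▸ hi)
      rw [Finset.erase_insert_of_ne hai, Finset.prod_insert (by simp [ha])]
      ring
  rw [key]
  refine Finset.sum_congr rfl fun i _ => ?_
  rw [Finset.prod_update_of_mem (Finset.mem_univ i), Finset.sdiff_singleton_eq_erase]

theorem prod_X_mk_update {n : ℕ} (f : Fin n → PlaneTree) (i : Fin n) (s : PlaneTree) :
    ∏ j, (X (RTree.mk (Function.update f i s j)) : HK k) =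
      ∏ j, Function.update (fun j => (X (RTree.mk (f j)) : HK k)) i (X (RTree.mk s)) j := by
  refine Finset.prod_congr rfl fun j _ => ?_
  exact Function.apply_update (fun _ t => (X (RTree.mk t) : HK k)) f i s j

variable (k) in
theorem BPlus_prod {n : ℕ} (f : Fin n → PlaneTree) :
    BPlus k (∏ i, X (RTree.mk (f i))) = X (RTree.mk (.node n f)) := by
  classical
  have h : (∏ i, X (RTree.mk (f i)) : HK k) =
      monomial (Multiset.toFinsupp (Finset.univ.val.map fun i => RTree.mk (f i))) 1 := by
    rw [monomial_eq_prod, Multiset.toFinsupp_toMultiset, Multiset.map_map]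
    rfl
  rw [h, BPlus_monomial, Multiset.toFinsupp_toMultiset, RTree.bPlus_map_mk]

variable (k) in
theorem exists_monomial_eq_prod (u : RTree →₀ ℕ) : ∃ (n : ℕ) (f : Fin n → PlaneTree),
    (monomial u 1 : HK k) = ∏ i, X (RTree.mk (f i)) := by
  classical
  induction u using forest_induction with
  | h0 => exact ⟨0, Fin.elim0, by simp⟩
  | h1 t u ih =>
    obtain ⟨n, f, h⟩ := ih
    refine ⟨n + 1, Fin.cons t.out f, ?_⟩
    rw [monomial_single_add, h, Fin.prod_univ_succ]
    simp [RTree.mk_out]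

/-- Linear maps on `H_K` that agree on all products of trees are equal. -/
theorem linearMap_ext_prod {M : Type*} [AddCommMonoid M] [Module k M] {L L' : HK k →ₗ[k] M}
    (h : ∀ (n : ℕ) (f : Fin n → PlaneTree),
      L (∏ i, X (RTree.mk (f i))) = L' (∏ i, X (RTree.mk (f i)))) : L = L' := by
  refine (basisMonomials RTree k).ext fun u => ?_
  rw [coe_basisMonomials]
  beta_reduce
  obtain ⟨n, f, hf⟩ := exists_monomial_eq_prod k u
  rw [hf, h]

/-- Growing a tree: either its branches grow, or a new edge is attached to the root. -/
theorem N_BPlus (x : HK k) :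
    N k (BPlus k x) = BPlus k (N k x) + BPlus k (X RTree.bullet * x) := by
  suffices h : (N k).toLinearMap ∘ₗ BPlus k =
      BPlus k ∘ₗ (N k).toLinearMap + BPlus k ∘ₗ LinearMap.mulLeft k (X RTree.bullet) from
    LinearMap.congr_fun h x
  refine linearMap_ext_prod fun n f => ?_
  simp only [LinearMap.comp_apply, LinearMap.add_apply, Derivation.coeFn_coe,
    LinearMap.mulLeft_apply]
  rw [BPlus_prod, N_X_mk, PlaneTree.sum_vert_node, derivation_prod, add_comm]
  congr 1
  · rw [map_sum]
    refine Finset.sum_congr rfl fun i _ => ?_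
    -- The updated factor is pulled out of the product so that its sum over vertices can be
    -- distributed, and is put back afterwards.
    rw [N_X_mk, Finset.prod_update_of_mem (Finset.mem_univ i), Finset.sum_mul, map_sum]
    refine Finset.sum_congr rfl fun v _ => ?_
    rw [← Finset.prod_update_of_mem (Finset.mem_univ i), ← prod_X_mk_update, BPlus_prod]
    rfl
  · have h : (X RTree.bullet * ∏ i, X (RTree.mk (f i)) : HK k) =
        ∏ i, X (RTree.mk ((Fin.cons PlaneTree.leaf f : Fin (n + 1) → PlaneTree) i)) := by
      rw [Fin.prod_univ_succ]
      rfl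
    rw [h, BPlus_prod]
    rfl

/-- Pruning a tree other than `•` means pruning the forest of its branches. -/
theorem P_BPlus_prod {n : ℕ} (f : Fin (n + 1) → PlaneTree) :
    P k (X (RTree.mk (.node (n + 1) f))) = BPlus k (P k (∏ i, X (RTree.mk (f i)))) := by
  classical
  rw [P_X_mk, if_neg (fun h => by injection h with h _; omega), zero_add, derivation_prod, map_sum,
    PlaneTree.sum_termEdge_node f fun e =>
      (X (RTree.mk (PlaneTree.prune (PlaneTree.node (n + 1) f) e)) : HK k)]
  refine Finset.sum_congr rfl fun i _ => ?_
  rw [P_X_mk, Finset.prod_update_of_mem (Finset.mem_univ i), add_mul, map_add, Finset.sum_mul,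
    map_sum]
  congr 1
  -- A branch equal to `•` contributes `P(•) = 1`, which deletes its factor; this matches cutting
  -- the edge from the root to that branch.
  · split_ifs with h
    · rw [← Finset.prod_update_of_mem (Finset.mem_univ i), Fin.prod_univ_succAbove _ i]
      simp only [Function.update_self, one_mul, ne_eq, Fin.succAbove_ne, not_false_eq_true,
        Function.update_of_ne]
      exact (BPlus_prod k fun j => f (i.succAbove j)).symm
    · simp
  · refine Finset.sum_congr rfl fun v _ => ?_
    rw [← Finset.prod_update_of_mem (Finset.mem_univ i), ← prod_X_mk_update, BPlus_prod]
    rfl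

end Algebra

end Kreimer

namespace Kreimer

section Algebra

variable {k : Type*} [Field k]

/-! ### Infinitesimal characters and the derivations they induce -/

theorem counit_mul (a b : HK k) : counit k (a * b) = counit k a * counit k b :=
  map_mul (aeval fun _ : RTree => (0 : k)) a b

theorem counit_one : counit k 1 = 1 :=
  map_one (aeval fun _ : RTree => (0 : k))

theorem counit_X (t : RTree) : counit k (X t) = 0 :=
  aeval_X _ _

theorem counit_eq_coeff (a : HK k) : counit k a = coeff 0 a := by
  simp [counit, aeval_zero', constantCoeff_eq]

/-- Linear functionals on `H_K` that are derivations with respect to the counit. -/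
def IsInfinitesimal (w : HK k →ₗ[k] k) : Prop :=
  ∀ a b, w (a * b) = w a * counit k b + counit k a * w b

theorem IsInfinitesimal.map_one {w : HK k →ₗ[k] k} (hw : IsInfinitesimal w) : w 1 = 0 := by
  have h := hw 1 1
  rw [mul_one, counit_one] at h
  simpa using h

theorem IsInfinitesimal.ext {w v : HK k →ₗ[k] k} (hw : IsInfinitesimal w)
    (hv : IsInfinitesimal v) (h : ∀ t, w (X t) = v (X t)) : w = v := by
  refine (basisMonomials RTree k).ext fun u => ?_
  rw [coe_basisMonomials]
  beta_reduce
  induction u using forest_induction with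
  | h0 => exact hw.map_one.trans hv.map_one.symm
  | h1 t u ih => rw [monomial_single_add, hw, hv, ih, h]

/-- A single tree factors as a monomial only as `t · 1` or `1 · t`. -/
theorem isInfinitesimal_Z (t : RTree) : IsInfinitesimal (Z k t).1 := by
  classical
  intro a b
  change coeff _ (a * b) = coeff _ a * _ + _ * coeff _ b
  rw [counit_eq_coeff, counit_eq_coeff, coeff_mul, Finsupp.antidiagonal_single, Finset.sum_map,
    show Finset.HasAntidiagonal.antidiagonal 1 = {(0, 1), (1, 0)} from rfl, Finset.sum_pair (by simp),
    add_comm]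
  simp

open Classical in
theorem Z_X (s t : RTree) : (Z k t).1 (X s) = if s = t then 1 else 0 := by
  change coeff _ (X s) = _
  rw [coeff_X]
  simp [Finsupp.single_left_inj]

/-- The contraction `w ⊗ id` of the left tensor factor with a functional `w`. -/
noncomputable def leftSlice (w : HK k →ₗ[k] k) : HK k ⊗[k] HK k →ₗ[k] HK k :=
  (TensorProduct.lid k (HK k)).toLinearMap ∘ₗ TensorProduct.map w LinearMap.id

theorem leftSlice_tmul (w : HK k →ₗ[k] k) (a b : HK k) : leftSlice w (a ⊗ₜ b) = w a • b := by
  simp [leftSlice]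

/-- The contraction `id ⊗ w` of the right tensor factor with a functional `w`. -/
noncomputable def rightSlice (w : HK k →ₗ[k] k) : HK k ⊗[k] HK k →ₗ[k] HK k :=
  (TensorProduct.rid k (HK k)).toLinearMap ∘ₗ TensorProduct.map LinearMap.id w

theorem rightSlice_tmul (w : HK k →ₗ[k] k) (a b : HK k) : rightSlice w (a ⊗ₜ b) = w b • a := by
  simp [rightSlice]

theorem leftSlice_mul {w : HK k →ₗ[k] k} (hw : IsInfinitesimal w) (x y : HK k ⊗[k] HK k) :
    leftSlice w (x * y) =
      leftSlice w x * leftSlice (counit k) y + leftSlice (counit k) x * leftSlice w y := by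
  induction x using TensorProduct.induction_on with
  | zero => simp
  | add x x' hx hx' => rw [add_mul, map_add, hx, hx', map_add, map_add]; ring
  | tmul a b =>
    induction y using TensorProduct.induction_on with
    | zero => simp
    | add y y' hy hy' => rw [mul_add, map_add, hy, hy', map_add, map_add]; ring
    | tmul c d =>
      simp only [Algebra.TensorProduct.tmul_mul_tmul, leftSlice_tmul, hw a c, add_smul,
        smul_mul_smul_comm]

theorem leftSlice_counit_mul (x y : HK k ⊗[k] HK k) :
    leftSlice (counit k) (x * y) = leftSlice (counit k) x * leftSlice (counit k) y := by
  induction x using TensorProduct.induction_on with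
  | zero => simp
  | add x x' hx hx' => rw [add_mul, map_add, hx, hx', map_add]; ring
  | tmul a b =>
    induction y using TensorProduct.induction_on with
    | zero => simp
    | add y y' hy hy' => rw [mul_add, map_add, hy, hy', map_add]; ring
    | tmul c d =>
      simp only [Algebra.TensorProduct.tmul_mul_tmul, leftSlice_tmul, counit_mul,
        smul_mul_smul_comm]

theorem rightSlice_counit_mul (x y : HK k ⊗[k] HK k) :
    rightSlice (counit k) (x * y) = rightSlice (counit k) x * rightSlice (counit k) y := by
  induction x using TensorProduct.induction_on with
  | zero => simp
  | add x x' hx hx' => rw [add_mul, map_add, hx, hx', map_add]; ring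
  | tmul a b =>
    induction y using TensorProduct.induction_on with
    | zero => simp
    | add y y' hy hy' => rw [mul_add, map_add, hy, hy', map_add]; ring
    | tmul c d =>
      simp only [Algebra.TensorProduct.tmul_mul_tmul, rightSlice_tmul, counit_mul,
        smul_mul_smul_comm]

theorem leftSlice_map_right (w : HK k →ₗ[k] k) (L : HK k →ₗ[k] HK k) (x : HK k ⊗[k] HK k) :
    leftSlice w (TensorProduct.map LinearMap.id L x) = L (leftSlice w x) := by
  induction x using TensorProduct.induction_on with
  | zero => simp
  | add x y hx hy => simp only [map_add, hx, hy]
  | tmul a b => simp [leftSlice_tmul]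

theorem counit_BPlus (x : HK k) : counit k (BPlus k x) = 0 := by
  suffices h : counit k ∘ₗ BPlus k = 0 from LinearMap.congr_fun h x
  refine linearMap_ext_prod fun n f => ?_
  rw [LinearMap.comp_apply, BPlus_prod, counit_X, LinearMap.zero_apply]

theorem rightSlice_map_BPlus (x : HK k ⊗[k] HK k) :
    rightSlice (counit k) (TensorProduct.map LinearMap.id (BPlus k) x) = 0 := by
  induction x using TensorProduct.induction_on with
  | zero => simp
  | add x y hx hy => simp only [map_add, hx, hy, add_zero]
  | tmul a b => simp [rightSlice_tmul, counit_BPlus]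

theorem comul_X_node {n : ℕ} (f : Fin n → PlaneTree) :
    comul k (X (RTree.mk (.node n f))) = X (RTree.mk (.node n f)) ⊗ₜ 1 +
      TensorProduct.map LinearMap.id (BPlus k) (comul k (∏ i, X (RTree.mk (f i)))) := by
  simp only [comul_X, comulTree, map_prod]

/-- A property of elements of `H_K` that holds for a product of trees whenever it holds for its
factors, and passes from the forest of branches to a tree. -/
theorem tree_induction {p : HK k → Prop} (one : p 1) (mul : ∀ a b, p a → p b → p (a * b))
    (node : ∀ (n : ℕ) (f : Fin n → PlaneTree),
      p (∏ i, X (RTree.mk (f i))) → p (X (RTree.mk (.node n f)))) :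
    ∀ t : PlaneTree, p (X (RTree.mk t))
  | .node n f => node n f <| Finset.prod_induction _ p mul one
      fun i _ => tree_induction one mul node (f i)

/-- The induction behind the identities for `Δ`. Neither map need be multiplicative: equality only
has to pass to products and from a forest to its `B₊`. -/
theorem linear_tree_induction {M : Type*} [AddCommMonoid M] [Module k M] {L L' : HK k →ₗ[k] M}
    (one : L 1 = L' 1) (mul : ∀ a b, L a = L' a → L b = L' b → L (a * b) = L' (a * b))
    (node : ∀ (n : ℕ) (f : Fin n → PlaneTree),
      L (∏ i, X (RTree.mk (f i))) = L' (∏ i, X (RTree.mk (f i))) →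
        L (X (RTree.mk (.node n f))) = L' (X (RTree.mk (.node n f)))) : L = L' :=
  linearMap_ext_prod fun _ f => Finset.prod_induction _ (fun a => L a = L' a) mul one
    fun i _ => tree_induction (p := fun a => L a = L' a) one mul node (f i)

theorem leftSlice_counit_comul (x : HK k) : leftSlice (counit k) (comul k x) = x := by
  suffices h : leftSlice (counit k) ∘ₗ (comul k).toLinearMap = LinearMap.id from
    LinearMap.congr_fun h x
  refine linear_tree_induction ?_ ?_ ?_
  · simp [Algebra.TensorProduct.one_def, leftSlice_tmul, counit_one]
  · intro a b ha hb
    simp only [LinearMap.comp_apply, AlgHom.toLinearMap_apply, LinearMap.id_apply, map_mul,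
      leftSlice_counit_mul] at *
    rw [ha, hb]
  · intro n f h
    simp only [LinearMap.comp_apply, AlgHom.toLinearMap_apply, LinearMap.id_apply] at *
    rw [comul_X_node, map_add, leftSlice_map_right, h, leftSlice_tmul, counit_X, zero_smul,
      zero_add, BPlus_prod]

/-- On a tree only `t ⊗ 1` survives, because the counit vanishes on the image of `B₊`. On the left
side the roles are reversed: `t ⊗ 1` dies and the induction hypothesis is needed. -/
theorem rightSlice_counit_comul (x : HK k) : rightSlice (counit k) (comul k x) = x := by
  suffices h : rightSlice (counit k) ∘ₗ (comul k).toLinearMap = LinearMap.id from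
    LinearMap.congr_fun h x
  refine linear_tree_induction ?_ ?_ ?_
  · simp [Algebra.TensorProduct.one_def, rightSlice_tmul, counit_one]
  · intro a b ha hb
    simp only [LinearMap.comp_apply, AlgHom.toLinearMap_apply, LinearMap.id_apply, map_mul,
      rightSlice_counit_mul] at *
    rw [ha, hb]
  · intro n f h
    simp only [LinearMap.comp_apply, AlgHom.toLinearMap_apply, LinearMap.id_apply] at *
    rw [comul_X_node, map_add, rightSlice_map_BPlus, rightSlice_tmul, counit_one, one_smul,
      add_zero]

/-- The derivation `(w ⊗ id) Δ` of `H_K` induced by an infinitesimal character `w`. -/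
noncomputable def sliceDerivation {w : HK k →ₗ[k] k} (hw : IsInfinitesimal w) :
    Derivation k (HK k) (HK k) :=
  Derivation.mk' (leftSlice w ∘ₗ (comul k).toLinearMap) fun a b => by
    simp only [LinearMap.comp_apply, AlgHom.toLinearMap_apply, map_mul, leftSlice_mul hw,
      leftSlice_counit_comul, smul_eq_mul]
    ring

theorem sliceDerivation_apply {w : HK k →ₗ[k] k} (hw : IsInfinitesimal w) (x : HK k) :
    sliceDerivation hw x = leftSlice w (comul k x) := rfl

theorem HKgr_mul_apply (w v : HKgr k) (x : HK k) :
    (w * v).1 x = LinearMap.mul' k k (TensorProduct.map w.1 v.1 (comul k x)) := rfl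

theorem apply_leftSlice (w v : HK k →ₗ[k] k) (x : HK k ⊗[k] HK k) :
    v (leftSlice w x) = LinearMap.mul' k k (TensorProduct.map w v x) := by
  induction x using TensorProduct.induction_on with
  | zero => simp
  | add x y hx hy => simp only [map_add, hx, hy]
  | tmul a b => simp [leftSlice_tmul]

theorem apply_rightSlice (w v : HK k →ₗ[k] k) (x : HK k ⊗[k] HK k) :
    w (rightSlice v x) = LinearMap.mul' k k (TensorProduct.map w v x) := by
  induction x using TensorProduct.induction_on with
  | zero => simp
  | add x y hx hy => simp only [map_add, hx, hy]
  | tmul a b => simp [rightSlice_tmul, mul_comm]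

theorem HKgr_one_mul (w : HKgr k) : 1 * w = w := by
  refine Subtype.ext (LinearMap.ext fun x => ?_)
  rw [HKgr_mul_apply, ← apply_leftSlice]
  exact congrArg w.1 (leftSlice_counit_comul x)

theorem HKgr_mul_one (w : HKgr k) : w * 1 = w := by
  refine Subtype.ext (LinearMap.ext fun x => ?_)
  rw [HKgr_mul_apply, ← apply_rightSlice]
  exact congrArg w.1 (rightSlice_counit_comul x)

theorem Z_mul_apply (t : RTree) (w : HKgr k) (x : HK k) :
    (Z k t * w).1 x = w.1 (sliceDerivation (isInfinitesimal_Z t) x) := by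
  rw [HKgr_mul_apply, ← apply_leftSlice]
  rfl

/-! ### The dual of the pruning operator -/

theorem Z_bullet_X_node {n : ℕ} (f : Fin n → PlaneTree) :
    (Z k RTree.bullet).1 (X (RTree.mk (.node n f))) = if n = 0 then 1 else 0 := by
  classical
  rw [Z_X]
  refine if_congr ?_ rfl rfl
  rw [PlaneTree.mk_eq_bullet_iff]
  constructor
  · intro h
    injection h
  · rintro rfl
    exact congrArg (PlaneTree.node 0) (Subsingleton.elim _ _)

/-- Write `D = (Z_• ⊗ id)Δ`. As `Z_• ⊗ id` commutes with `id ⊗ B₊`, the recursion for `Δ` gives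
`D(B₊(x)) = Z_•(B₊(x)) · 1 + B₊(D(x))`. The first term is nonzero only for `•`, where it accounts
for `P(•) = 1`; otherwise this is the recursion for `P`. -/
theorem sliceDerivation_Z_bullet :
    sliceDerivation (isInfinitesimal_Z (k := k) RTree.bullet) = P k := by
  refine Derivation.ext fun x => ?_
  suffices h : (sliceDerivation (isInfinitesimal_Z (k := k) RTree.bullet)).toLinearMap =
    (P k).toLinearMap from LinearMap.congr_fun h x
  refine linear_tree_induction ?_ ?_ ?_
  · simp
  · intro a b ha hb
    simp only [Derivation.coeFn_coe, Derivation.leibniz] at *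
    rw [ha, hb]
  · intro n f h
    simp only [Derivation.coeFn_coe] at *
    rw [sliceDerivation_apply] at h ⊢
    rw [comul_X_node, map_add, leftSlice_map_right, h, leftSlice_tmul, Z_bullet_X_node]
    rcases n with _ | n
    · classical
      rw [P_X_mk, if_pos (show PlaneTree.node 0 f = PlaneTree.leaf from
        congrArg (PlaneTree.node 0) (Subsingleton.elim _ _))]
      have : IsEmpty (PlaneTree.node 0 f).TermEdge := ⟨fun e => Fin.elim0
        (e : Σ i : Fin 0, PLift (_ = PlaneTree.leaf) ⊕ PlaneTree.TermEdge _).1⟩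
      simp
    · rw [P_BPlus_prod]
      simp

theorem Pstar_eq (w : HKgr k) : Pstar k w = Z k RTree.bullet * w := by
  refine Subtype.ext (LinearMap.ext fun x => ?_)
  rw [Z_mul_apply, sliceDerivation_Z_bullet]
  rfl

/-! ### The growth operator and the coproduct -/

variable (k) in
/-- The derivation of `H_K` multiplying elements of degree `r` by `r`. -/
noncomputable def degDerivation : Derivation k (HK k) (HK k) :=
  mkDerivation k fun t => (t.size : k) • X t

theorem degDerivation_prod {n : ℕ} (f : Fin n → PlaneTree) :
    degDerivation k (∏ i, X (RTree.mk (f i))) =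
      ((∑ i, (f i).size : ℕ) : k) • ∏ i, X (RTree.mk (f i)) := by
  rw [derivation_prod, Nat.cast_sum, Finset.sum_smul]
  refine Finset.sum_congr rfl fun i _ => ?_
  rw [degDerivation, mkDerivation_X, Finset.prod_update_of_mem (Finset.mem_univ i),
    Finset.sdiff_singleton_eq_erase, smul_mul_assoc,
    Finset.mul_prod_erase _ (fun j => (X (RTree.mk (f j)) : HK k)) (Finset.mem_univ i)]
  rfl

theorem degDerivation_monomial (u : RTree →₀ ℕ) :
    degDerivation k (monomial u 1) = (Finsupp.weight RTree.size u : k) • monomial u 1 := by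
  induction u using forest_induction with
  | h0 => simp
  | h1 t u ih =>
    rw [monomial_single_add, Derivation.leibniz, ih, degDerivation, mkDerivation_X, map_add,
      Finsupp.weight_single, one_smul, Nat.cast_add, add_smul, smul_eq_mul, smul_eq_mul,
      mul_smul_comm, mul_smul_comm, add_comm, mul_comm]

theorem degDerivation_BPlus (x : HK k) :
    degDerivation k (BPlus k x) = BPlus k (degDerivation k x) + BPlus k x := by
  suffices h : (degDerivation k).toLinearMap ∘ₗ BPlus k =
      BPlus k ∘ₗ (degDerivation k).toLinearMap + BPlus k from LinearMap.congr_fun h x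
  refine linearMap_ext_prod fun n f => ?_
  simp only [LinearMap.comp_apply, LinearMap.add_apply, Derivation.coeFn_coe]
  rw [degDerivation_prod, map_smul, BPlus_prod, degDerivation, mkDerivation_X]
  change ((1 + ∑ i, (f i).size : ℕ) : k) • _ = _
  rw [Nat.cast_add, Nat.cast_one, add_comm, add_smul, one_smul]

variable (k) in
/-- The operator `N ⊗ id + id ⊗ N + • ⊗ Y` on `H_K ⊗ H_K`, where `Y` multiplies by the degree. -/
noncomputable def growTensor : HK k ⊗[k] HK k →ₗ[k] HK k ⊗[k] HK k :=
  TensorProduct.map (N k).toLinearMap LinearMap.id +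
    TensorProduct.map LinearMap.id (N k).toLinearMap +
    TensorProduct.map (LinearMap.mulLeft k (X RTree.bullet)) (degDerivation k).toLinearMap

theorem growTensor_tmul (a b : HK k) : growTensor k (a ⊗ₜ b) =
    N k a ⊗ₜ b + a ⊗ₜ N k b + (X RTree.bullet * a) ⊗ₜ degDerivation k b := by
  simp [growTensor]

theorem growTensor_mul (x y : HK k ⊗[k] HK k) :
    growTensor k (x * y) = growTensor k x * y + x * growTensor k y := by
  induction x using TensorProduct.induction_on with
  | zero => simp
  | add x x' hx hx' => rw [add_mul, map_add, hx, hx', map_add]; ring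
  | tmul a b =>
    induction y using TensorProduct.induction_on with
    | zero => simp
    | add y y' hy hy' => rw [mul_add, map_add, hy, hy', map_add]; ring
    | tmul c d =>
      simp only [growTensor_tmul, Algebra.TensorProduct.tmul_mul_tmul, Derivation.leibniz,
        smul_eq_mul, add_mul, mul_add, TensorProduct.add_tmul, TensorProduct.tmul_add]
      rw [mul_comm c (N k a), mul_comm d (N k b), mul_comm d (degDerivation k b),
        mul_left_comm a (X RTree.bullet) c, mul_assoc (X RTree.bullet) a c]
      abel

theorem comul_X_bullet : comul k (X RTree.bullet) = X RTree.bullet ⊗ₜ 1 + 1 ⊗ₜ X RTree.bullet := by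
  have h := comul_X_node (k := k) Fin.elim0
  -- The second factor `1` is turned back into an empty product, so that `BPlus_prod` evaluates
  -- `B₊(1)` to `•`.
  rw [Finset.prod_of_isEmpty, map_one, Algebra.TensorProduct.one_def, TensorProduct.map_tmul,
    ← Finset.prod_of_isEmpty (Finset.univ : Finset (Fin 0)), BPlus_prod k Fin.elim0] at h
  simpa [RTree.bullet, PlaneTree.leaf] using h

/-- The counterpart of `N_BPlus` on the tensor square. For `a ⊗ b`, the new root edge in `N B₊(b)`
yields `a ⊗ • b`, and the degree increase in `Y B₊(b)` yields `• a ⊗ b`; together they form `Δ(•)(a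
⊗ b)`. This is why the term `• ⊗ Y` is there. -/
theorem growTensor_map_BPlus (x : HK k ⊗[k] HK k) :
    growTensor k (TensorProduct.map LinearMap.id (BPlus k) x) =
      TensorProduct.map LinearMap.id (BPlus k)
        (growTensor k x + comul k (X RTree.bullet) * x) := by
  induction x using TensorProduct.induction_on with
  | zero => simp
  | add x y hx hy => simp only [map_add, mul_add, hx, hy]; abel
  | tmul a b =>
    simp only [growTensor_tmul, comul_X_bullet, TensorProduct.map_tmul, LinearMap.id_apply,
      N_BPlus, degDerivation_BPlus, add_mul, Algebra.TensorProduct.tmul_mul_tmul, one_mul, map_add,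
      TensorProduct.tmul_add]
    abel

theorem comul_BPlus_apply (x : HK k) : comul k (BPlus k x) =
    BPlus k x ⊗ₜ[k] 1 + TensorProduct.map LinearMap.id (BPlus k) (comul k x) := by
  suffices h : (comul k).toLinearMap ∘ₗ BPlus k =
      (TensorProduct.mk k (HK k) (HK k)).flip 1 ∘ₗ BPlus k +
        TensorProduct.map LinearMap.id (BPlus k) ∘ₗ (comul k).toLinearMap from
    LinearMap.congr_fun h x
  refine (basisMonomials RTree k).ext fun u => ?_
  rw [coe_basisMonomials]
  exact comul_BPlus k u

theorem comul_N (x : HK k) : comul k (N k x) = growTensor k (comul k x) := by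
  suffices h : (comul k).toLinearMap ∘ₗ (N k).toLinearMap =
    growTensor k ∘ₗ (comul k).toLinearMap from LinearMap.congr_fun h x
  refine linear_tree_induction ?_ ?_ ?_
  · simp [Algebra.TensorProduct.one_def, growTensor_tmul]
  · intro a b ha hb
    simp only [LinearMap.comp_apply, Derivation.coeFn_coe, AlgHom.toLinearMap_apply,
      Derivation.leibniz, smul_eq_mul, map_mul, map_add, growTensor_mul] at *
    rw [ha, hb]
    ring
  · intro n f h
    simp only [LinearMap.comp_apply, Derivation.coeFn_coe, AlgHom.toLinearMap_apply] at *
    -- With `x` the forest of branches, both sides become `N B₊(x) ⊗ 1 + (id ⊗ B₊)Δ(N x + • x)`; on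
    -- `B₊(x) ⊗ 1` only `N ⊗ id` contributes, since `N` and `Y` kill `1`.
    rw [← BPlus_prod, N_BPlus, ← map_add, comul_BPlus_apply, comul_BPlus_apply,
      map_add (growTensor k), growTensor_map_BPlus, map_add (comul k), h, map_mul, map_add (BPlus k), ← N_BPlus,
      growTensor_tmul]
    simp

end Algebra

end Kreimer

namespace Kreimer

section Algebra

variable {k : Type*} [Field k]

/-! ### The dual of the growth operator -/

theorem counit_N (x : HK k) : counit k (N k x) = 0 := by
  suffices h : counit k ∘ₗ (N k).toLinearMap = 0 from LinearMap.congr_fun h x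
  refine (basisMonomials RTree k).ext fun u => ?_
  rw [coe_basisMonomials]
  simp only [LinearMap.comp_apply, Derivation.coeFn_coe, LinearMap.zero_apply]
  induction u using forest_induction with
  | h0 => simp
  | h1 t u ih =>
    rw [monomial_single_add, Derivation.leibniz, map_add, smul_eq_mul, smul_eq_mul, counit_mul,
      counit_mul, ih, N, mkDerivation_X, growTree, map_sum]
    simp [counit_X]

theorem IsInfinitesimal.comp_N {w : HK k →ₗ[k] k} (hw : IsInfinitesimal w) :
    IsInfinitesimal (w ∘ₗ (N k).toLinearMap) := by
  intro a b
  simp only [LinearMap.comp_apply, Derivation.coeFn_coe, Derivation.leibniz, smul_eq_mul, map_add,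
    hw a, hw b, counit_N]
  ring

theorem isInfinitesimal_sum {ι : Type*} (s : Finset ι) (c : ι → k) (w : ι → HK k →ₗ[k] k)
    (hw : ∀ i ∈ s, IsInfinitesimal (w i)) : IsInfinitesimal (∑ i ∈ s, c i • w i) := by
  intro a b
  simp only [LinearMap.sum_apply, LinearMap.smul_apply, Finset.sum_mul, Finset.mul_sum,
    ← Finset.sum_add_distrib]
  refine Finset.sum_congr rfl fun i hi => ?_
  rw [hw i hi a b, smul_eq_mul, smul_eq_mul, smul_eq_mul]
  ring

/-- Both sides are infinitesimal characters (`Z_t ∘ N` is one because the counit kills the image of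
`N`), so they need only be compared on trees. Allowing `r = 0` includes `•`, for which the sum is
empty. -/
theorem Nstar_Z {r : ℕ} (t : RTree) (ht : t.size = r + 1) :
    Nstar k (Z k t) = ∑ t' ∈ RTree.ofSize r, (RTree.n t' t : k) • Z k t' := by
  classical
  refine Subtype.ext ?_
  rw [AddSubmonoidClass.coe_finsetSum]
  refine IsInfinitesimal.ext (isInfinitesimal_Z t).comp_N
    (isInfinitesimal_sum _ _ (fun s => (Z k s).1) fun s _ => isInfinitesimal_Z s) fun s => ?_
  change (Z k t).1 (N k (X s)) = _
  rw [N, mkDerivation_X, growTree, map_sum, LinearMap.sum_apply]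
  simp only [map_smul, SetLike.val_smul, LinearMap.smul_apply, Z_X, smul_eq_mul, mul_ite,
    mul_one, mul_zero, Finset.sum_ite_eq, Finset.sum_ite_eq', RTree.mem_ofSize, ht]
  exact if_congr (by omega) rfl rfl

theorem Nstar_Z_bullet : Nstar k (Z k RTree.bullet) = 0 := by
  rw [Nstar_Z (r := 0) RTree.bullet rfl]
  refine Finset.sum_eq_zero fun t ht => ?_
  have h := t.size_pos
  rw [RTree.mem_ofSize.1 ht] at h
  omega

/-! ### The partial derivative -/

theorem mul_X_mem {r : ℕ} (t : RTree) {x : HK k} (hx : x ∈ HKdeg k r) :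
    X t * x ∈ HKdeg k (t.size + r) :=
  IsWeightedHomogeneous.mul (isWeightedHomogeneous_X _ _ _) hx

variable (k) in
/-- The dual of multiplication by `•`. -/
noncomputable def partialZBullet : HKgr k →ₗ[k] HKgr k :=
  ((LinearMap.mulLeft k (X RTree.bullet : HK k)).dualMap.domRestrict
    (gradedDual k)).codRestrict (gradedDual k) fun w => by
      obtain ⟨w, a, ha⟩ := w
      exact ⟨a, fun r hr x hx => ha _ (by omega) _ (mul_X_mem RTree.bullet hx)⟩

theorem partialZBullet_apply (w : HKgr k) (x : HK k) :
    (partialZBullet k w).1 x = w.1 (X RTree.bullet * x) := rfl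

/-- Primitivity of `•`, dualized: applied to `Δ(• y) = Δ(•)Δ(y)`, it is the Leibniz rule for
`partialZBullet`. -/
theorem map_tensor_comul_X_bullet_mul (w v : HKgr k) (x : HK k ⊗[k] HK k) :
    LinearMap.mul' k k (TensorProduct.map w.1 v.1 (comul k (X RTree.bullet) * x)) =
      LinearMap.mul' k k (TensorProduct.map (partialZBullet k w).1 v.1 x) +
        LinearMap.mul' k k (TensorProduct.map w.1 (partialZBullet k v).1 x) := by
  induction x using TensorProduct.induction_on with
  | zero => simp
  | add x y hx hy => simp only [mul_add, map_add, hx, hy]; ring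
  | tmul a b =>
    rw [comul_X_bullet, add_mul]
    simp [partialZBullet_apply]

theorem isPartialZBullet_partialZBullet : IsPartialZBullet (partialZBullet k) where
  leibniz w v := by
    refine Subtype.ext (LinearMap.ext fun x => ?_)
    rw [partialZBullet_apply, HKgr_mul_apply, map_mul, map_tensor_comul_X_bullet_mul]
    rfl
  apply_Z t := by
    classical
    refine Subtype.ext (LinearMap.ext fun x => ?_)
    rw [partialZBullet_apply, isInfinitesimal_Z, counit_X, zero_mul, add_zero, Z_X]
    simp only [eq_comm (a := t)]
    split_ifs
    · exact one_mul _
    · exact zero_mul _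

/-! ### Generation of the graded dual by the `Z_t`, and uniqueness of the derivation. -/

/-- The element of the graded dual taking the coefficient of a monomial. -/
noncomputable def monomialDual (u : RTree →₀ ℕ) : HKgr k :=
  ⟨lcoeff k u, Finsupp.weight RTree.size u + 1, fun r hr x hx => by
    by_contra h
    have h1 := hx h
    omega⟩

theorem monomialDual_apply (u : RTree →₀ ℕ) (x : HK k) :
    (monomialDual u : HKgr k).1 x = coeff u x := rfl

theorem finite_weight_lt (a : ℕ) : {u : RTree →₀ ℕ | Finsupp.weight RTree.size u < a}.Finite := by
  classical
  have hS : {t : RTree | t.size < a}.Finite := by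
    refine ((Finset.range a).biUnion RTree.ofSize).finite_toSet.subset fun t ht => ?_
    exact Finset.mem_biUnion.2 ⟨t.size, Finset.mem_range.2 ht, RTree.mem_ofSize.2 rfl⟩
  -- Trees have positive size, so a forest of degree below `a` uses only trees of size below `a`,
  -- each fewer than `a` times: it lies in a finite box.
  refine (Set.finite_Iic (∑ t ∈ hS.toFinset, Finsupp.single t a)).subset fun u hu t => ?_
  replace hu : Finsupp.weight RTree.size u < a := hu
  rcases Nat.eq_zero_or_pos (u t) with h0 | h0
  · omega
  · have h1 := Finsupp.le_weight_of_ne_zero' RTree.size h0.ne'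
    have h2 := Finsupp.le_weight RTree.size t.size_pos.ne' u
    rw [Finsupp.finsetSum_apply, Finset.sum_eq_single_of_mem t
      (by simpa using lt_of_le_of_lt h1 hu) fun s _ hs => by simp [hs]]
    simp only [Finsupp.single_eq_same]
    omega

/-- An element of the graded dual is a linear combination of the duals of those monomials on which
it does not vanish. -/
theorem mem_span_monomialDual (w : HKgr k) :
    w ∈ Submodule.span k (monomialDual '' {u | w.1 (monomial u 1) ≠ 0}) := by
  classical
  obtain ⟨a, ha⟩ := w.2
  have hfin : {u : RTree →₀ ℕ | w.1 (monomial u 1) ≠ 0}.Finite := by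
    refine (finite_weight_lt a).subset fun u hu => ?_
    by_contra h
    exact hu (ha _ (not_lt.1 h) _ (isWeightedHomogeneous_monomial _ _ _ rfl))
  have hw : w = ∑ u ∈ hfin.toFinset, w.1 (monomial u 1) • monomialDual u := by
    refine Subtype.ext ((basisMonomials RTree k).ext fun u => ?_)
    rw [coe_basisMonomials, AddSubmonoidClass.coe_finsetSum, LinearMap.sum_apply]
    simp only [SetLike.val_smul, LinearMap.smul_apply, monomialDual_apply, coeff_monomial,
      smul_eq_mul, mul_ite, mul_one, mul_zero, Finset.sum_ite_eq, Set.Finite.mem_toFinset,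
      Set.mem_ofPred_eq]
    split_ifs with h
    · rfl
    · exact not_not.1 h
  -- Only the element is replaced by the sum; `w` must stay in the description of the spanning set.
  refine (congrArg (· ∈ Submodule.span k (monomialDual '' {u | w.1 (monomial u 1) ≠ 0})) hw).mpr ?_
  exact Submodule.sum_mem _ fun u hu => Submodule.smul_mem _ _ <|
    Submodule.subset_span ⟨u, hfin.mem_toFinset.1 hu, rfl⟩

theorem counit_leftSlice_comul (w : HK k →ₗ[k] k) (x : HK k) :
    counit k (leftSlice w (comul k x)) = w x := by
  rw [apply_leftSlice, ← apply_rightSlice, rightSlice_counit_comul]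

/-- Up to terms with more factors, `(Z_t ⊗ id) Δ` is the partial derivative with respect to `t`. -/
theorem sliceDerivation_sub_pderiv_mem (t : RTree) (u : RTree →₀ ℕ) :
    sliceDerivation (isInfinitesimal_Z (k := k) t) (monomial u 1) - pderiv t (monomial u 1) ∈
      idealOfVars RTree k ^ u.degree := by
  classical
  have hX : ∀ s, X s ∈ idealOfVars RTree k := fun s => Ideal.subset_span ⟨s, rfl⟩
  rw [← Derivation.sub_apply]
  induction u using forest_induction with
  | h0 => simp
  | h1 s u ih =>
    rw [monomial_single_add, Derivation.leibniz, map_add, Finsupp.degree_single, add_comm 1,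
      pow_succ']
    refine add_mem (Ideal.mul_mem_mul (hX s) ih) ?_
    rw [smul_eq_mul, mul_comm (monomial u 1)]
    refine Ideal.mul_mem_mul ?_ ((monomial_mem_pow_idealOfVars_iff _ _ one_ne_zero).2 le_rfl)
    -- On a single tree `s` the difference must have zero constant term: `(Z_t ⊗ id)Δ(s)` has
    -- constant term `Z_t(s)`, which is also the value of the partial derivative.
    rw [← pow_one (idealOfVars RTree k), mem_pow_idealOfVars_iff']
    intro v hv
    obtain rfl : v = 0 := (Finsupp.degree_eq_zero_iff v).1 (by simpa using hv)
    rw [← counit_eq_coeff, Derivation.sub_apply, map_sub, sliceDerivation_apply,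
      counit_leftSlice_comul, Z_X, pderiv_X, Pi.single_apply]
    split_ifs <;> simp [counit_one]

/-- On monomials with more factors than `u`, the correction to the partial derivative lies in too
high a power of the ideal to contribute to the coefficient of `u`. The factor `u t + 1` is the
exponent brought down by differentiation. -/
theorem Z_mul_monomialDual_apply (t : RTree) (u v : RTree →₀ ℕ) (hv : u.degree < v.degree) :
    (Z k t * monomialDual u).1 (monomial v 1) =
      ((u t + 1 : k) • (monomialDual (Finsupp.single t 1 + u) : HKgr k)).1 (monomial v 1) := by
  have h := (mem_pow_idealOfVars_iff' _ _).1 (sliceDerivation_sub_pderiv_mem (k := k) t v) u hv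
  rw [coeff_sub, sub_eq_zero, coeff_pderiv] at h
  rw [Z_mul_apply, monomialDual_apply, h, SetLike.val_smul, LinearMap.smul_apply,
    monomialDual_apply, smul_eq_mul, add_comm u, mul_comm]

/-- In characteristic `0`, a subspace of the graded dual that contains `1` and is stable under left
multiplication by all `Z_t` is everything. -/
theorem eq_top_of_Z_mul_mem [CharZero k] (K : Submodule k (HKgr k)) (h1 : 1 ∈ K)
    (hZ : ∀ t, ∀ w ∈ K, Z k t * w ∈ K) : K = ⊤ := by
  have key : ∀ n (u : RTree →₀ ℕ), u.degree = n → monomialDual u ∈ K := by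
    intro n
    induction n using Nat.strong_induction_on with
    | _ n ih =>
      intro u hu
      induction u using forest_induction with
      | h0 =>
        convert h1
        exact Subtype.ext (LinearMap.ext fun x => (counit_eq_coeff x).symm)
      | h1 t u _ =>
        rw [map_add, Finsupp.degree_single] at hu
        set c : k := u t + 1
        -- Characteristic `0` enters here: the leading coefficient must be invertible.
        have hc : c ≠ 0 := Nat.cast_add_one_ne_zero _
        set R : HKgr k := Z k t * monomialDual u - c • monomialDual (Finsupp.single t 1 + u) with hR
        -- The remainder `R` is supported on monomials with fewer than `n` factors, whose duals lie
        -- in `K` by the induction on the number of factors.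
        have hRK : R ∈ K := by
          refine Submodule.span_le.2 ?_ (mem_span_monomialDual R)
          rintro _ ⟨v, hv, rfl⟩
          refine ih v.degree ?_ v rfl
          by_contra hlt
          refine hv ?_
          rw [hR, AddSubgroupClass.coe_sub, LinearMap.sub_apply,
            Z_mul_monomialDual_apply t u v (by omega), sub_self]
        have h2 : c • monomialDual (Finsupp.single t 1 + u) ∈ K := by
          have h : c • monomialDual (Finsupp.single t 1 + u) =
              Z k t * monomialDual u + (-1 : k) • R := by
            rw [hR]
            module
          rw [h]
          exact K.add_mem (hZ t _ (ih u.degree (by omega) u rfl)) (K.smul_mem _ hRK)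
        exact (Submodule.smul_mem_iff K hc).1 h2
  refine Submodule.eq_top_iff'.2 fun w => Submodule.span_le.2 ?_ (mem_span_monomialDual w)
  rintro _ ⟨u, _, rfl⟩
  exact key _ u rfl

theorem IsPartialZBullet.map_one {d : HKgr k →ₗ[k] HKgr k} (hd : IsPartialZBullet d) :
    d 1 = 0 := by
  have h := hd.leibniz 1 1
  rw [HKgr_one_mul, HKgr_mul_one, HKgr_one_mul] at h
  simpa using h

theorem IsPartialZBullet.unique [CharZero k] {d d' : HKgr k →ₗ[k] HKgr k}
    (hd : IsPartialZBullet d) (hd' : IsPartialZBullet d') : d = d' := by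
  refine LinearMap.eqLocus_eq_top.1 (eq_top_of_Z_mul_mem _ ?_ fun t w hw => ?_)
  · exact hd.map_one.trans hd'.map_one.symm
  · rw [LinearMap.mem_eqLocus] at hw ⊢
    rw [hd.leibniz, hd'.leibniz, hd.apply_Z, hd'.apply_Z, hw]

/-! ### The twisted Leibniz rule -/

theorem apply_degDerivation {v : HKgr k} {r : ℕ} (hv : v ∈ HKgrDeg k r) (x : HK k) :
    v.1 (degDerivation k x) = ((r : k) • v).1 x := by
  suffices h : v.1 ∘ₗ (degDerivation k).toLinearMap = ((r : k) • v).1 from LinearMap.congr_fun h x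
  refine (basisMonomials RTree k).ext fun u => ?_
  rw [coe_basisMonomials, LinearMap.comp_apply, Derivation.coeFn_coe, degDerivation_monomial,
    map_smul, SetLike.val_smul, LinearMap.smul_apply]
  rcases eq_or_ne (Finsupp.weight RTree.size u) r with h | h
  · rw [h]
  · rw [hv _ h (monomial u 1) (isWeightedHomogeneous_monomial _ _ _ rfl), smul_zero, smul_zero]

theorem map_tensor_growTensor (w : HKgr k) {v : HKgr k} {r : ℕ} (hv : v ∈ HKgrDeg k r)
    (x : HK k ⊗[k] HK k) :
    LinearMap.mul' k k (TensorProduct.map w.1 v.1 (growTensor k x)) =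
      LinearMap.mul' k k (TensorProduct.map (Nstar k w).1 v.1 x) +
        LinearMap.mul' k k (TensorProduct.map w.1 (Nstar k v).1 x) +
        LinearMap.mul' k k (TensorProduct.map (partialZBullet k w).1 ((r : k) • v).1 x) := by
  induction x using TensorProduct.induction_on with
  | zero => simp
  | add x y hx hy => simp only [map_add, hx, hy]; ring
  | tmul a b =>
    simp only [growTensor_tmul, map_add, TensorProduct.map_tmul, LinearMap.mul'_apply,
      apply_degDerivation hv, partialZBullet_apply]
    rfl

/-- The dual of `comul_N`: the three summands of `growTensor` give the three terms, `Y` acting on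
`v` as its degree `r`. -/
theorem Nstar_mul (w : HKgr k) {v : HKgr k} {r : ℕ} (hv : v ∈ HKgrDeg k r) :
    Nstar k (w * v) =
      Nstar k w * v + w * Nstar k v + partialZBullet k w * ((r : k) • v) := by
  refine Subtype.ext (LinearMap.ext fun x => ?_)
  change (w * v).1 (N k x) = _
  rw [HKgr_mul_apply, comul_N, map_tensor_growTensor w hv]
  rfl

end Algebra

end Kreimer

theorem proposition3p6 (k : Type*) [Field k] [CharZero k] :
    -- the values of `N*` on the generators `Z_t`
    Kreimer.Nstar k (Kreimer.Z k Kreimer.RTree.bullet) = 0 ∧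
    (∀ t : Kreimer.RTree, 2 ≤ t.size →
      Kreimer.Nstar k (Kreimer.Z k t) =
        ∑ t' ∈ Kreimer.RTree.ofSize (t.size - 1), (Kreimer.RTree.n t' t : k) • Kreimer.Z k t') ∧
    -- `∂/∂Z_•` is well defined, and `N*` obeys the twisted Leibniz rule
    (∃! d : Kreimer.HKgr k →ₗ[k] Kreimer.HKgr k, Kreimer.IsPartialZBullet d) ∧
    (∀ d : Kreimer.HKgr k →ₗ[k] Kreimer.HKgr k, Kreimer.IsPartialZBullet d →
      ∀ (w v : Kreimer.HKgr k) (r : ℕ), v ∈ Kreimer.HKgrDeg k r →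
        Kreimer.Nstar k (w * v) =
          Kreimer.Nstar k w * v + w * Kreimer.Nstar k v + d w * ((r : k) • v)) ∧
    -- `P*` is left multiplication by `Z_•`
    (∀ w : Kreimer.HKgr k, Kreimer.Pstar k w = Kreimer.Z k Kreimer.RTree.bullet * w) := by
  have hp := Kreimer.isPartialZBullet_partialZBullet (k := k)
  refine ⟨Kreimer.Nstar_Z_bullet, fun t ht => Kreimer.Nstar_Z t (by omega),
    ⟨_, hp, fun d hd => hd.unique hp⟩, fun d hd w v r hv => ?_, Kreimer.Pstar_eq⟩
  rw [hd.unique hp]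
  exact Kreimer.Nstar_mul w hv
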